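/- Let $\mathbb T$ be the unit circle with normalized arc length, $L^2=L^2(\mathbb T)$, $L^\infty=L^\infty(\mathbb T)$, let $P_+$ be the orthogonal projection of $L^2$ onto the Hardy space $H^2$ and $P_-=I-P_+$. For $H=\left(\begin{smallmatrix} f&\phi\\ g&\psi\end{smallmatrix}\right)$ with entries in $L^\infty$, the generalized singular integral operator (GSIO) $R_H$ on $L^2$ is $$R_Hx=P_+fP_+x+P_-gP_+x+P_+\phi P_-x+P_-\psi P_-x .$$ Let $\mathfrak R_{L^\infty}\subset B(L^2)$ be the C*-algebra generated by all $R_H$ with $H\in L^\infty_{2\times 2}$ (the norm closure of the finite sums of finite products of such operators), and let $\mathfrak{SR}_{L^\infty}$ be the closed two-sided ideal of $\mathfrak R_{L^\infty}$ generated by all operators $$R_{\left(\begin{smallmatrix} f_1&\phi_1\\ g_1&\psi_1\end{smallmatrix}\right)}R_{\left(\begin{smallmatrix} f_2&\phi_2\\ g_2&\psi_2\end{smallmatrix}\right)}-R_{\left(\begin{smallmatrix} f_1f_2&\phi\\ g&\psi_1\psi_2\end{smallmatrix}\right)},\qquad f_i,g_i,\phi_i,\psi_i,g,\phi\in L^\infty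 .$$ Let $k_w(z)=\sqrt{1-|w|^2}/(1-\bar wz)$, $|w|<1$, be the normalized reproducing kernel of $H^2$, and give $L^\infty\oplus L^\infty$ the coordinatewise operations and the norm $\|(a,b)\|=\max\{\|a\|_\infty,\|b\|_\infty\}$. Then for every $T\in\mathfrak R_{L^\infty}$ the limits in $$\rho(T)(\xi)=\Big(\lim_{r\to1^-}\langle Tk_{r\xi},k_{r\xi}\rangle,\ \lim_{r\to1^-}\langle T\bar z\bar k_{r\xi},\bar z\bar k_{r\xi}\rangle\Big)$$ exist for almost every $\xi\in\mathbb T$ and define a unital $*$-homomorphism $\rho:\mathfrak R_{L^\infty}\to L^\infty\oplus L^\infty$; the sequence $$0\longrightarrow\mathfrak{SR}_{L^\infty}\longrightarrow\mathfrak R_{L^\infty}\overset{\rho}{\longrightarrow}L^\infty\oplus L^\infty\longrightarrow0$$ (with the inclusion as first map) is exact; and $\rho$ induces an isometric $*$-isomorphism of the quotient algebra $\mathfrak R_{L^\infty}/\mathfrak{SR}_{L^\infty}$, with its quotient norm, onto $L^\infty\oplus L^\infty$. -/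

import Mathlib

open MeasureTheory Filter Topology
open scoped ENNReal ComplexConjugate InnerProductSpace

noncomputable section

namespace GSIO

/-! ### The circle and its Lebesgue spaces -/

/-- The unit circle, parametrized by the angle: `t : 𝕋` stands for the point
`AddCircle.toCircle t = exp (i t)`. -/
abbrev 𝕋 : Type := AddCircle (2 * Real.pi)

instance : Fact (0 < 2 * Real.pi) := ⟨Real.two_pi_pos⟩

/-- Normalized arc length `dθ / 2π`. -/
abbrev arc : Measure 𝕋 := AddCircle.haarAddCircle

/-- The point of the complex plane given by an angle. -/
def pt (t : 𝕋) : ℂ := (AddCircle.toCircle t : ℂ)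

abbrev L2 : Type := Lp ℂ 2 arc

abbrev LInf : Type := Lp ℂ ∞ arc

/-! ### `L^∞` as a commutative `*`-algebra under the pointwise almost everywhere operations.
Addition, scalar multiplication, norm and conjugation are Mathlib's. -/

instance : Mul LInf := ⟨fun f g => (ContinuousLinearMap.mul ℂ ℂ).holder ∞ f g⟩

instance : One LInf := ⟨(memLp_const (1 : ℂ)).toLp (fun _ : 𝕋 => (1 : ℂ))⟩

theorem coeFn_mul (f g : LInf) : ⇑(f * g) =ᵐ[arc] fun t => f t * g t :=
  (ContinuousLinearMap.mul ℂ ℂ).coeFn_holder f g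

theorem coeFn_one : ⇑(1 : LInf) =ᵐ[arc] fun _ => (1 : ℂ) :=
  MemLp.coeFn_toLp _

theorem linf_mul_add (f g h : LInf) : f * (g + h) = f * g + f * h := by
  apply Lp.ext
  filter_upwards [coeFn_mul f (g + h), coeFn_mul f g, coeFn_mul f h, Lp.coeFn_add g h,
    Lp.coeFn_add (f * g) (f * h)] with t h1 h2 h3 h4 h5
  simp only [h1, h5, Pi.add_apply, h2, h3, h4, mul_add]

theorem linf_mul_comm (f g : LInf) : f * g = g * f := by
  apply Lp.ext
  filter_upwards [coeFn_mul f g, coeFn_mul g f] with t h1 h2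
  rw [h1, h2, mul_comm]

theorem linf_mul_assoc (f g h : LInf) : f * g * h = f * (g * h) := by
  apply Lp.ext
  filter_upwards [coeFn_mul (f * g) h, coeFn_mul f g, coeFn_mul f (g * h), coeFn_mul g h]
    with t h1 h2 h3 h4
  rw [h1, h2, h3, h4, mul_assoc]

theorem linf_one_mul (f : LInf) : 1 * f = f := by
  apply Lp.ext
  filter_upwards [coeFn_mul 1 f, coeFn_one] with t h1 h2
  rw [h1, h2, one_mul]

theorem linf_zero_mul (f : LInf) : 0 * f = 0 := by
  apply Lp.ext
  filter_upwards [coeFn_mul 0 f, Lp.coeFn_zero ℂ ∞ arc] with t h1 h2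
  rw [h1, h2, Pi.zero_apply, zero_mul]

instance : CommRing LInf :=
  { (inferInstance : AddCommGroup LInf) with
    mul := (· * ·)
    one := 1
    mul_assoc := linf_mul_assoc
    mul_comm := linf_mul_comm
    one_mul := linf_one_mul
    mul_one := fun f => by rw [linf_mul_comm, linf_one_mul]
    zero_mul := linf_zero_mul
    mul_zero := fun f => by rw [linf_mul_comm, linf_zero_mul]
    left_distrib := linf_mul_add
    right_distrib := fun f g h => by
      rw [linf_mul_comm, linf_mul_add, linf_mul_comm h f, linf_mul_comm h g] }

theorem linf_smul_mul (c : ℂ) (f g : LInf) : (c • f) * g = c • (f * g) := by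
  apply Lp.ext
  filter_upwards [coeFn_mul (c • f) g, coeFn_mul f g, Lp.coeFn_smul c f,
    Lp.coeFn_smul c (f * g)] with t h1 h2 h3 h4
  simp only [h1, h4, Pi.smul_apply, h2, h3, smul_eq_mul, mul_assoc]

instance : Algebra ℂ LInf :=
  Algebra.ofModule linf_smul_mul fun c f g => by
    rw [mul_comm f (c • g), linf_smul_mul, mul_comm g f]

instance : StarRing LInf where
  star_mul f g := by
    apply Lp.ext
    filter_upwards [Lp.coeFn_star (f * g), coeFn_mul f g, coeFn_mul (star g) (star f),
      Lp.coeFn_star f, Lp.coeFn_star g] with t h1 h2 h3 h4 h5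
    simp only [h1, h3, Pi.star_apply, h2, h4, h5, star_mul]
  star_add f g := by
    apply Lp.ext
    filter_upwards [Lp.coeFn_star (f + g), Lp.coeFn_add f g, Lp.coeFn_add (star f) (star g),
      Lp.coeFn_star f, Lp.coeFn_star g] with t h1 h2 h3 h4 h5
    simp only [h1, h3, Pi.star_apply, Pi.add_apply, h2, h4, h5, star_add]

/-! ### Generalized singular integral operators -/

/-- Multiplication by `f ∈ L^∞` as a bounded operator on `L²`. -/
def mulOp (f : LInf) : L2 →L[ℂ] L2 := (ContinuousLinearMap.mul ℂ ℂ).holderL arc ∞ 2 2 f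

theorem coeFn_mulOp (f : LInf) (x : L2) : ⇑(mulOp f x) =ᵐ[arc] fun t => f t * x t :=
  (ContinuousLinearMap.mul ℂ ℂ).coeFn_holder f x

/-- The Hardy space `H²`: the closed linear span in `L²` of `zⁿ`, `n ≥ 0`. -/
def hardy : Submodule ℂ L2 :=
  (Submodule.span ℂ (Set.range fun n : ℕ => (fourierLp 2 (n : ℤ) : L2))).topologicalClosure

instance : CompleteSpace hardy :=
  inferInstanceAs (CompleteSpace (Submodule.topologicalClosure _))

/-- The orthogonal projection of `L²` onto `H²`. -/
def Pplus : L2 →L[ℂ] L2 := hardy.starProjection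

/-- `P₋ = I - P₊`. -/
def Pminus : L2 →L[ℂ] L2 := 1 - Pplus

/-- The operator `R_H` with symbol `H = !![f, φ; g, ψ]`. -/
def R (H : Matrix (Fin 2) (Fin 2) LInf) : L2 →L[ℂ] L2 :=
  Pplus * mulOp (H 0 0) * Pplus + Pminus * mulOp (H 1 0) * Pplus
    + Pplus * mulOp (H 0 1) * Pminus + Pminus * mulOp (H 1 1) * Pminus

theorem star_mulOp (f : LInf) : star (mulOp f) = mulOp (star f) := by
  rw [ContinuousLinearMap.star_eq_adjoint, eq_comm, ContinuousLinearMap.eq_adjoint_iff]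
  intro x y
  rw [L2.inner_def, L2.inner_def]
  apply integral_congr_ae
  filter_upwards [coeFn_mulOp (star f) x, coeFn_mulOp f y, Lp.coeFn_star f] with t h1 h2 h3
  simp only [h1, h2, h3, Pi.star_apply, RCLike.inner_apply, map_mul, RCLike.star_def,
    Complex.conj_conj]
  ring

theorem star_Pplus : star Pplus = Pplus := isSelfAdjoint_starProjection hardy

theorem star_Pminus : star Pminus = Pminus := by
  rw [Pminus, star_sub, star_one, star_Pplus]

theorem star_R (H : Matrix (Fin 2) (Fin 2) LInf) : star (R H) = R H.conjTranspose := by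
  simp only [R, star_add, star_mul, star_mulOp, star_Pplus, star_Pminus,
    Matrix.conjTranspose_apply, mul_assoc]
  abel

/-- The C*-algebra `ℜ_{L^∞}` generated by all `R_H`, `H ∈ L^∞_{2×2}`. As `R_H* = R_{H*}`
(`star_R`), it is the operator norm closure of the finite sums of finite products of `R_H`. -/
def RAlg : StarSubalgebra ℂ (L2 →L[ℂ] L2) :=
  (StarAlgebra.adjoin ℂ (Set.range R)).topologicalClosure

theorem R_mem (H : Matrix (Fin 2) (Fin 2) LInf) : R H ∈ RAlg :=
  StarSubalgebra.le_topologicalClosure _ (StarAlgebra.subset_adjoin ℂ _ ⟨H, rfl⟩)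

/-- `R_H` as an element of the algebra. -/
def Rel (H : Matrix (Fin 2) (Fin 2) LInf) : RAlg := ⟨R H, R_mem H⟩

/-- The operators `R_{H₁} R_{H₂} - R_{!![f₁ f₂, φ; g, ψ₁ ψ₂]}`. -/
def semicommutators : Set RAlg :=
  {T | ∃ (H₁ H₂ : Matrix (Fin 2) (Fin 2) LInf) (φ g : LInf),
    T = Rel H₁ * Rel H₂ - Rel !![H₁ 0 0 * H₂ 0 0, φ; g, H₁ 1 1 * H₂ 1 1]}

/-- The closed ideal `𝔖ℜ_{L^∞}`: the smallest closed two-sided ideal of the algebra that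
contains the operators above. -/
def SR : Ideal RAlg :=
  sInf {I : Ideal RAlg | I.IsTwoSided ∧ IsClosed (I : Set RAlg) ∧ semicommutators ⊆ I}

theorem mem_SR {T : RAlg} : T ∈ SR ↔ ∀ I : Ideal RAlg, I.IsTwoSided →
    IsClosed (I : Set RAlg) → semicommutators ⊆ I → T ∈ I := by
  simp [SR, Submodule.mem_sInf]

instance : SR.IsTwoSided where
  mul_mem_of_left {_} b ha := mem_SR.2 fun I h1 h2 h3 =>
    h1.mul_mem_of_left b (mem_SR.1 ha I h1 h2 h3)

theorem star_semicommutators {T : RAlg} (hT : T ∈ semicommutators) :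
    star T ∈ semicommutators := by
  obtain ⟨H₁, H₂, φ, g, rfl⟩ := hT
  have hs (H : Matrix (Fin 2) (Fin 2) LInf) : star (Rel H) = Rel H.conjTranspose :=
    Subtype.ext (star_R H)
  refine ⟨H₂.conjTranspose, H₁.conjTranspose, star g, star φ, ?_⟩
  have hm : (!![H₁ 0 0 * H₂ 0 0, φ; g, H₁ 1 1 * H₂ 1 1]).conjTranspose =
      !![H₂.conjTranspose 0 0 * H₁.conjTranspose 0 0, star g;
        star φ, H₂.conjTranspose 1 1 * H₁.conjTranspose 1 1] := by
    ext1 i j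
    fin_cases i <;> fin_cases j
    · exact star_mul _ _
    · rfl
    · rfl
    · exact star_mul _ _
  rw [star_sub, star_mul, hs, hs, hs, hm]

theorem star_mem_SR {T : RAlg} (hT : T ∈ SR) : star T ∈ SR := by
  refine mem_SR.2 fun I h1 h2 h3 => ?_
  let J : Ideal RAlg :=
    { carrier := {x | star x ∈ I}
      add_mem' := fun {a b} ha hb => by
        simpa only [Set.mem_ofPred_eq, star_add] using I.add_mem ha hb
      zero_mem' := by simp
      smul_mem' := fun c x hx => by
        simpa only [Set.mem_ofPred_eq, smul_eq_mul, star_mul] using h1.mul_mem_of_left _ hx }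
  refine mem_SR.1 hT J ⟨fun {a} b ha => ?_⟩ ?_ fun x hx => h3 (star_semicommutators hx)
  · change star (a * b) ∈ I
    rw [star_mul]
    exact I.mul_mem_left _ ha
  · exact h2.preimage continuous_star

/-- The involution of the quotient algebra, `(T + 𝔖ℜ)* = T* + 𝔖ℜ`. -/
instance : Star (RAlg ⧸ SR) where
  star := Quotient.map' star fun a b h => by
    rw [Submodule.quotientRel_def] at h ⊢
    rw [← star_sub]
    exact star_mem_SR h

/-! ### Normalized reproducing kernels -/

/-- `k_z(ω) = √(1 - |z|²) / (1 - z̄ ω)`, for `|z| < 1`. -/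
def kernelFun (z : ℂ) (t : 𝕋) : ℂ :=
  (Real.sqrt (1 - ‖z‖ ^ 2) : ℂ) / (1 - conj z * pt t)

theorem memLp_kernelFun (z : ℂ) : MemLp (kernelFun z) 2 arc := by
  rcases lt_or_ge ‖z‖ 1 with hz | hz
  · have hc : Continuous (kernelFun z) := by
      unfold kernelFun pt
      refine continuous_const.div (continuous_const.sub (continuous_const.mul
        (continuous_subtype_val.comp AddCircle.continuous_toCircle))) fun t h => ?_
      have : ‖conj z * (AddCircle.toCircle t : ℂ)‖ = 1 := by
        rw [← sub_eq_zero.1 h, norm_one]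
      rw [norm_mul, RCLike.norm_conj, Circle.norm_coe, mul_one] at this
      exact hz.ne this
    exact (ContinuousMap.mk _ hc).memLp arc ℂ
  · have : kernelFun z = fun _ => 0 := by
      funext t
      rw [kernelFun, Real.sqrt_eq_zero_of_nonpos (by nlinarith)]
      simp
    rw [this]
    exact MemLp.zero'

/-- `k_z` as a vector of `L²`. Only `|z| < 1` matters (it is `0` otherwise). -/
def k (z : ℂ) : L2 := (memLp_kernelFun z).toLp _

theorem memLp_antiKernelFun (z : ℂ) :
    MemLp (fun t => conj (pt t) * conj (kernelFun z t)) 2 arc := by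
  refine (memLp_kernelFun z).of_le ?_ (Eventually.of_forall fun t => ?_)
  · have h : Continuous fun t : 𝕋 => conj (pt t) :=
      Complex.continuous_conj.comp
        (continuous_subtype_val.comp AddCircle.continuous_toCircle)
    exact h.aestronglyMeasurable.mul
      (Complex.continuous_conj.comp_aestronglyMeasurable (memLp_kernelFun z).1)
  · rw [norm_mul, RCLike.norm_conj, RCLike.norm_conj, pt, Circle.norm_coe, one_mul]

/-- The vector `ω ↦ ω̄ · conj (k_z(ω))` of `L²`. -/
def antiK (z : ℂ) : L2 := (memLp_antiKernelFun z).toLp _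

end GSIO

end

noncomputable section

namespace GSIO

/-! ### Radial limits of Poisson integrals -/

/-! The unit vectors `k (r ξ)` are asymptotic eigenvectors. Since |k_{rξ}|² is the Poisson kernel,
‖(f - f(ξ)) k_{rξ}‖ → 0 at almost every Lebesgue point ξ of a bounded f, while `Pplus` fixes k_{rξ}
and `Pminus` kills it. The vectors `antiK (r ξ)` have the same modulus, with the roles of the
projections exchanged. So R_H has asymptotic eigenvalue f along the first family and ψ along the
second (`hasSymbol_k_R`, `hasSymbol_antiK_R`).

Having an asymptotic eigenvalue a.e. (`HasSymbol`) survives sums, products and norm limits, and the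
eigenvalue depends multiplicatively and contractively on the operator. Hence it exists on the whole
algebra, and taking inner products with the unit vectors gives the radial limits, the adjoint rule
and ‖ρ(T)‖ ≤ ‖T‖.

For exactness, ρ has the contractive linear section `diagRel`, which is multiplicative modulo `SR`.
An induction from the generators gives T - diagRel(ρ(T)) ∈ `SR` for every T, so ker ρ ⊆ `SR`.
Conversely ker ρ is a closed two-sided ideal containing the semicommutators. As both ρ and its
section are contractive, the induced isomorphism is isometric. -/

theorem norm_le_pi (t : 𝕋) : ‖t‖ ≤ Real.pi := by
  have := AddCircle.norm_le_half_period (p := 2 * Real.pi) (x := t) Real.two_pi_pos.ne'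
  rw [abs_of_pos Real.two_pi_pos] at this
  linarith

/-- Jordan's inequality for |1 - e^{ix}| = 2|sin(x/2)|, with the representative |x| ≤ π. -/
theorem two_div_pi_mul_norm_le (t : 𝕋) : 2 / Real.pi * ‖t‖ ≤ ‖1 - pt t‖ := by
  obtain ⟨x, hx, rfl⟩ : ∃ x : ℝ, |x| ≤ Real.pi ∧ (x : 𝕋) = t := by
    obtain ⟨x, rfl⟩ := QuotientAddGroup.mk_surjective t
    refine ⟨x - round ((2 * Real.pi)⁻¹ * x) * (2 * Real.pi), ?_, ?_⟩
    · exact (AddCircle.norm_eq (p := 2 * Real.pi)).symm.le.trans (norm_le_pi _)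
    · have h := AddCircle.coe_zsmul (p := 2 * Real.pi) (n := round ((2 * Real.pi)⁻¹ * x))
        (x := 2 * Real.pi)
      rw [AddCircle.coe_period, smul_zero, zsmul_eq_mul] at h
      rw [AddCircle.coe_sub, h, sub_zero]
  have hn : ‖(x : 𝕋)‖ = |x| := by
    rw [AddCircle.norm_coe_eq_abs_iff (2 * Real.pi) Real.two_pi_pos.ne', abs_of_pos Real.two_pi_pos]
    linarith
  have hp : pt (x : 𝕋) = Complex.exp (Complex.I * x) := by
    rw [pt, AddCircle.toCircle_apply_mk, div_self Real.two_pi_pos.ne', one_mul, Circle.coe_exp,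
      mul_comm]
  rw [hn, hp, norm_sub_rev, Complex.norm_exp_I_mul_ofReal_sub_one, norm_mul, Real.norm_eq_abs,
    Real.norm_eq_abs, abs_two]
  have h := Real.mul_abs_le_abs_sin (x := x / 2) (by rw [abs_div, abs_two]; linarith)
  rw [abs_div, abs_two] at h
  linarith

theorem norm_pt (t : 𝕋) : ‖pt t‖ = 1 := Circle.norm_coe _

theorem conj_pt_mul_pt (s t : 𝕋) : conj (pt s) * pt t = pt (t - s) := by
  rw [pt, pt, pt, sub_eq_add_neg, AddCircle.toCircle_add, AddCircle.toCircle_neg, Circle.coe_mul,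
    Circle.coe_inv_eq_conj, mul_comm]

theorem norm_one_sub_mul_sq {z : ℂ} (hz : ‖z‖ = 1) (r : ℝ) :
    ‖1 - r * z‖ ^ 2 = (1 - r) ^ 2 + r * ‖1 - z‖ ^ 2 := by
  have h : z.re * z.re + z.im * z.im = 1 := by
    rw [← Complex.normSq_apply, Complex.normSq_eq_norm_sq, hz, one_pow]
  simp only [← Complex.normSq_eq_norm_sq, Complex.normSq_apply, Complex.sub_re, Complex.sub_im,
    Complex.one_re, Complex.one_im, Complex.re_ofReal_mul, Complex.im_ofReal_mul]
  linear_combination (r ^ 2 - r) * h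

/-- The left side is the Poisson kernel (1 - r²)/|1 - r e^{i(t-ξ)}|². The constant is 10 = 2 · 5:
the numerator is at most 2(1 - r), and r ≥ 1/2 with (2/π)² ≥ 2/5 costs a factor 5 in the
denominator. -/
theorem norm_kernelFun_sq_le {r : ℝ} (h0 : 1 / 2 ≤ r) (h1 : r < 1) (ξ t : 𝕋) :
    ‖kernelFun (r * pt ξ) t‖ ^ 2 ≤ 10 * ((1 - r) / ((1 - r) ^ 2 + dist t ξ ^ 2)) := by
  have hr : 0 < r := by linarith
  have hd : 0 < 1 - r := by linarith
  have hn : ‖(r : ℂ) * pt ξ‖ = r := by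
    rw [norm_mul, norm_pt, mul_one, Complex.norm_real, Real.norm_of_nonneg hr.le]
  have hsq : 0 ≤ 1 - r ^ 2 := by nlinarith
  have hden : 1 - conj ((r : ℂ) * pt ξ) * pt t = 1 - r * pt (t - ξ) := by
    rw [map_mul, Complex.conj_ofReal, mul_assoc, conj_pt_mul_pt]
  rw [kernelFun, norm_div, div_pow, hn, hden, norm_one_sub_mul_sq (norm_pt _), Complex.norm_real,
    Real.norm_of_nonneg (Real.sqrt_nonneg _), Real.sq_sqrt hsq, dist_eq_norm, ← mul_div_assoc]
  have hb := two_div_pi_mul_norm_le (t - ξ)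
  have hb2 : 2 / 5 * ‖t - ξ‖ ^ 2 ≤ ‖1 - pt (t - ξ)‖ ^ 2 := by
    have h3 : (2 / Real.pi * ‖t - ξ‖) ^ 2 ≤ ‖1 - pt (t - ξ)‖ ^ 2 := by gcongr
    refine le_trans ?_ h3
    rw [mul_pow]
    gcongr
    rw [div_pow, div_le_div_iff₀ (by norm_num) (by positivity)]
    nlinarith [Real.pi_lt_d2, Real.pi_pos]
  rw [div_le_div_iff₀ (by positivity) (by positivity)]
  have h4 : (1 - r) ^ 2 + ‖t - ξ‖ ^ 2 ≤ 5 * ((1 - r) ^ 2 + r * ‖1 - pt (t - ξ)‖ ^ 2) := by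
    nlinarith [sq_nonneg ‖1 - pt (t - ξ)‖, sq_nonneg (1 - r)]
  nlinarith [mul_le_mul_of_nonneg_left h4 hsq, mul_le_mul_of_nonneg_left h4 hd.le,
    sq_nonneg ‖1 - pt (t - ξ)‖, sq_nonneg (1 - r), mul_nonneg hr.le (sq_nonneg ‖1 - pt (t - ξ)‖)]

/-- A Cauchy kernel is dominated by a weighted sum of indicators of dyadic balls. -/
theorem exists_dyadic_le {δ d : ℝ} (hδ : 0 < δ) :
    ∃ j : ℕ, d ≤ 2 ^ j * δ ∧ δ / (δ ^ 2 + d ^ 2) ≤ 4 * (1 / 4) ^ j / δ := by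
  have hex : ∃ j : ℕ, d ≤ 2 ^ j * δ := by
    obtain ⟨n, hn⟩ := pow_unbounded_of_one_lt (d / δ) (one_lt_two (α := ℝ))
    exact ⟨n, ((div_lt_iff₀ hδ).1 hn).le⟩
  classical
  -- With the least j, either j = 0 and the kernel is at most 1/δ, or d > 2^(j-1) δ, which gives the
  -- factor 4 · 4^(-j).
  refine ⟨Nat.find hex, Nat.find_spec hex, ?_⟩
  rw [div_le_div_iff₀ (by positivity) hδ]
  rcases hj : Nat.find hex with _ | j
  · nlinarith [sq_nonneg d, sq_nonneg δ]
  · have h := Nat.find_min hex (m := j) (by omega)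
    push Not at h
    have h2 : (2 ^ j * δ) ^ 2 ≤ d ^ 2 := by gcongr
    have h3 : (1 / 4 : ℝ) ^ j * (2 ^ j) ^ 2 = 1 := by
      rw [← pow_mul, mul_comm j 2, pow_mul, ← mul_pow]; norm_num
    have h4 : (0 : ℝ) < (1 / 4) ^ j := by positivity
    rw [pow_succ]
    nlinarith [mul_le_mul_of_nonneg_left h2 h4.le, sq_nonneg δ, mul_nonneg h4.le (sq_nonneg δ)]

/-- Integrating the dyadic bound, 40 = 10 · 4. One factor 2^(-j) of 4^(-j) normalizes the mass of
the ball by its radius; the other keeps the series summable. -/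
theorem lintegral_mul_kernelFun_le {u : 𝕋 → ℝ} (hu : Integrable u volume) (hu0 : ∀ t, 0 ≤ u t)
    {r : ℝ} (h0 : 1 / 2 ≤ r) (h1 : r < 1) (ξ : 𝕋) :
    ∫⁻ t, ENNReal.ofReal (u t) * ‖kernelFun (r * pt ξ) t‖ₑ ^ 2 ≤
      ∑' j : ℕ, ENNReal.ofReal (40 * (1 / 2) ^ j *
        ((∫ t in Metric.closedBall ξ (2 ^ j * (1 - r)), u t) / (2 ^ j * (1 - r)))) := by
  have hδ : 0 < 1 - r := by linarith
  have hpt (t : 𝕋) : ENNReal.ofReal (u t) * ‖kernelFun (r * pt ξ) t‖ₑ ^ 2 ≤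
      ∑' j : ℕ, (Metric.closedBall ξ (2 ^ j * (1 - r))).indicator
        (fun t => ENNReal.ofReal (40 * (1 / 4) ^ j / (1 - r)) * ENNReal.ofReal (u t)) t := by
    obtain ⟨j, hj, hle⟩ := exists_dyadic_le (d := dist t ξ) hδ
    refine le_trans ?_ (ENNReal.le_tsum j)
    rw [Set.indicator_of_mem (Metric.mem_closedBall.2 hj), mul_comm, ← ofReal_norm,
      ← ENNReal.ofReal_pow (norm_nonneg _)]
    gcongr
    refine (norm_kernelFun_sq_le h0 h1 ξ t).trans ?_
    calc _ ≤ 10 * (4 * (1 / 4) ^ j / (1 - r)) := by gcongr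
      _ = _ := by ring
  have hum : AEMeasurable (fun t => ENNReal.ofReal (u t)) volume :=
    hu.1.aemeasurable.ennreal_ofReal
  refine (lintegral_mono hpt).trans ?_
  rw [lintegral_tsum fun j => (hum.const_mul _).indicator Metric.isClosed_closedBall.measurableSet]
  refine ENNReal.tsum_le_tsum fun j => ?_
  rw [lintegral_indicator Metric.isClosed_closedBall.measurableSet,
    lintegral_const_mul'' _ hum.restrict,
    ← ofReal_integral_eq_lintegral_ofReal hu.integrableOn (Eventually.of_forall hu0),
    ← ENNReal.ofReal_mul (by positivity)]
  refine ENNReal.ofReal_le_ofReal (le_of_eq ?_)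
  have h4 : (1 / 4 : ℝ) ^ j = (1 / 2) ^ j * (1 / 2) ^ j := by rw [← mul_pow]; norm_num
  have h2 : (1 / 2 : ℝ) ^ j * 2 ^ j = 1 := by rw [← mul_pow]; norm_num
  have h2' : (2 : ℝ) ^ j ≠ 0 := by positivity
  rw [h4]
  generalize (∫ t in Metric.closedBall ξ (2 ^ j * (1 - r)), u t) = m
  field_simp
  linear_combination h2 * m

/-- Dominated convergence in the dyadic series: for fixed j the radius 2^j (1 - r) shrinks to 0, so
each term vanishes in the limit. -/
theorem tendsto_lintegral_mul_kernelFun {u : 𝕋 → ℝ} (hu : Integrable u volume)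
    (hu0 : ∀ t, 0 ≤ u t) {ξ : 𝕋}
    (hξ : Tendsto (fun s => ⨍ t in Metric.closedBall ξ s, u t) (𝓝[>] 0) (𝓝 0)) :
    Tendsto (fun r : ℝ => ∫⁻ t, ENNReal.ofReal (u t) * ‖kernelFun (r * pt ξ) t‖ₑ ^ 2)
      (𝓝[<] 1) (𝓝 0) := by
  set A : ℝ → ℝ := fun s => (∫ t in Metric.closedBall ξ s, u t) / s with hA
  have hm0 (s : ℝ) : 0 ≤ ∫ t in Metric.closedBall ξ s, u t := integral_nonneg hu0
  have hA0 : Tendsto A (𝓝[>] 0) (𝓝 0) := by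
    have h2 := hξ.const_mul 2
    rw [mul_zero] at h2
    refine h2.congr' ?_
    filter_upwards [Ioo_mem_nhdsGT Real.pi_pos] with s hs
    have hv : volume.real (Metric.closedBall ξ s) = 2 * s := by
      rw [measureReal_def, AddCircle.volume_closedBall, min_eq_right (by linarith [hs.2]),
        ENNReal.toReal_ofReal (by linarith [hs.1])]
    rw [setAverage_eq, hv, smul_eq_mul, hA]
    have := hs.1.ne'
    field_simp
  -- The bound must hold at all radii, as 2^j (1 - r) is unbounded in j. Small radii use the limit,
  -- large ones the total mass of u.
  obtain ⟨B, hB⟩ : ∃ B, ∀ s, 0 < s → A s ≤ B := by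
    obtain ⟨η, hη, h⟩ := mem_nhdsGT_iff_exists_Ioo_subset.1
      (hA0.eventually (eventually_le_nhds zero_lt_one))
    refine ⟨max 1 ((∫ t, u t) / η), fun s hs => ?_⟩
    rcases lt_or_ge s η with hsη | hsη
    · exact (h ⟨hs, hsη⟩).trans (le_max_left _ _)
    · refine le_trans ?_ (le_max_right _ _)
      have : 0 ≤ ∫ t, u t := integral_nonneg hu0
      refine div_le_div₀ this ?_ hη hsη
      exact setIntegral_le_integral hu (Eventually.of_forall hu0)
  have hsum : Tendsto (fun r : ℝ => ∑' j : ℕ, 40 * (1 / 2) ^ j * A (2 ^ j * (1 - r)))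
      (𝓝[<] 1) (𝓝 (∑' _ : ℕ, (0 : ℝ))) := by
    refine tendsto_tsum_of_dominated_convergence (bound := fun j : ℕ => 40 * (1 / 2) ^ j * B)
      ?_ (fun j => ?_) ?_
    · exact ((summable_geometric_two).mul_left 40).mul_right B
    · have hs : Tendsto (fun r : ℝ => 2 ^ j * (1 - r)) (𝓝[<] 1) (𝓝[>] 0) := by
        refine tendsto_nhdsWithin_iff.2 ⟨?_, ?_⟩
        · refine (Continuous.tendsto' (by fun_prop) _ _ (by simp)).mono_left nhdsWithin_le_nhds
        · filter_upwards [self_mem_nhdsWithin] with r hr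
          have : 0 < 1 - r := sub_pos.2 hr
          exact Set.mem_Ioi.2 (by positivity)
      have := (hA0.comp hs).const_mul (40 * (1 / 2) ^ j)
      rwa [mul_zero] at this
    · filter_upwards [self_mem_nhdsWithin] with r hr j
      have hr' : 0 < 1 - r := sub_pos.2 hr
      have hp : 0 < 2 ^ j * (1 - r) := by positivity
      rw [Real.norm_of_nonneg (mul_nonneg (by positivity) (div_nonneg (hm0 _) hp.le))]
      gcongr
      exact hB _ hp
  rw [tsum_zero] at hsum
  have hof := ENNReal.tendsto_ofReal hsum
  rw [ENNReal.ofReal_zero] at hof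
  refine tendsto_of_tendsto_of_tendsto_of_le_of_le' tendsto_const_nhds hof
    (Eventually.of_forall fun _ => zero_le) ?_
  filter_upwards [Ico_mem_nhdsLT (show (1 / 2 : ℝ) < 1 by norm_num)] with r hr
  refine (lintegral_mul_kernelFun_le hu hu0 hr.1 hr.2 ξ).trans ?_
  have hr' : 0 < 1 - r := sub_pos.2 hr.2
  have hnn (j : ℕ) : 0 ≤ 40 * (1 / 2) ^ j * A (2 ^ j * (1 - r)) :=
    mul_nonneg (by positivity) (div_nonneg (hm0 _) (by positivity))
  rw [ENNReal.ofReal_tsum_of_nonneg hnn]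
  refine Summable.of_nonneg_of_le hnn (fun j => ?_)
    (((summable_geometric_two).mul_left 40).mul_right B)
  gcongr
  exact hB _ (by positivity)

theorem volume_eq_smul_arc : (volume : Measure 𝕋) = ENNReal.ofReal (2 * Real.pi) • arc := rfl

theorem arc_le_volume : arc ≤ (volume : Measure 𝕋) := by
  rw [volume_eq_smul_arc]
  refine Measure.le_iff.2 fun s _ => ?_
  rw [Measure.smul_apply, smul_eq_mul]
  refine le_mul_of_one_le_left zero_le (ENNReal.one_le_ofReal.2 ?_)
  linarith [Real.pi_gt_three]

theorem norm_coe_ae_le (f : LInf) : ∀ᵐ t ∂arc, ‖f t‖ ≤ ‖f‖ := by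
  have h := ae_le_eLpNormEssSup (f := f) (μ := arc)
  filter_upwards [h] with t ht
  rw [← eLpNorm_exponent_top] at ht
  rw [Lp.norm_def, ← toReal_enorm]
  exact ENNReal.toReal_mono (Lp.eLpNorm_ne_top f) ht

/-- Almost every ξ is a Lebesgue point, and |f(t) - f(ξ)| ≤ 2‖f‖ reduces the square to a first
power. -/
theorem ae_tendsto_lintegral_kernelFun (f : LInf) :
    ∀ᵐ ξ ∂arc, Tendsto
      (fun r : ℝ => ∫⁻ t, ‖f t - f ξ‖ₑ ^ 2 * ‖kernelFun (r * pt ξ) t‖ₑ ^ 2 ∂arc)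
      (𝓝[<] 1) (𝓝 0) := by
  have hi : Integrable f arc := (Lp.memLp f).integrable le_top
  have hiv : Integrable f volume := by
    rw [volume_eq_smul_arc]
    exact hi.smul_measure ENNReal.ofReal_ne_top
  have hac : arc ≪ (volume : Measure 𝕋) := Measure.absolutelyContinuous_of_le arc_le_volume
  filter_upwards [norm_coe_ae_le f, hac.ae_le
    (IsUnifLocDoublingMeasure.ae_tendsto_average_norm_sub volume hiv.locallyIntegrable 1)]
    with ξ hξ hav
  have h := tendsto_lintegral_mul_kernelFun (u := fun t => ‖f t - f ξ‖)
    (hiv.sub (integrable_const _)).norm (fun t => norm_nonneg _) (ξ := ξ)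
    (hav (fun _ => ξ) id tendsto_id (by
      filter_upwards [self_mem_nhdsWithin] with s hs
      rw [one_mul]
      exact Metric.mem_closedBall_self (le_of_lt hs)))
  have h2 := ENNReal.Tendsto.const_mul (a := ENNReal.ofReal (2 * ‖f‖)) h
    (Or.inr ENNReal.ofReal_ne_top)
  rw [mul_zero] at h2
  refine tendsto_of_tendsto_of_tendsto_of_le_of_le tendsto_const_nhds h2
    (fun _ => zero_le) fun r => ?_
  refine le_trans ?_ (mul_le_mul_right (lintegral_mono' arc_le_volume le_rfl) _)
  rw [← lintegral_const_mul' _ _ ENNReal.ofReal_ne_top]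
  refine lintegral_mono_ae ?_
  filter_upwards [norm_coe_ae_le f] with t ht
  rw [← mul_assoc, sq, ofReal_norm]
  gcongr
  rw [← ofReal_norm]
  refine ENNReal.ofReal_le_ofReal ((norm_sub_le _ _).trans ?_)
  linarith

/-! ### The kernel vectors -/

theorem coeFn_k (z : ℂ) : ⇑(k z) =ᵐ[arc] kernelFun z := MemLp.coeFn_toLp _

theorem coeFn_antiK (z : ℂ) : ⇑(antiK z) =ᵐ[arc] fun t => conj (pt t) * conj (kernelFun z t) :=
  MemLp.coeFn_toLp _

/-- The geometric series converges uniformly, its ratio having sup norm |z| < 1; the continuous map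
from C(𝕋) to L² carries the sum over. -/
theorem hasSum_k {z : ℂ} (hz : ‖z‖ < 1) :
    HasSum (fun n : ℕ => ((Real.sqrt (1 - ‖z‖ ^ 2) : ℂ) * conj z ^ n) • (fourierLp 2 (n : ℤ) : L2))
      (k z) := by
  set a : C(𝕋, ℂ) := conj z • fourier 1 with ha
  have han : ‖a‖ < 1 := by rwa [ha, norm_smul, fourier_norm, mul_one, RCLike.norm_conj]
  have hs : Summable fun n : ℕ => a ^ n := summable_geometric_of_norm_lt_one han
  have hm := geom_series_mul_neg a han
  have happ (t : 𝕋) : (∑' n : ℕ, a ^ n) t = (1 - conj z * pt t)⁻¹ := by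
    refine eq_inv_of_mul_eq_one_left ?_
    have h := DFunLike.congr_fun hm t
    simpa [ha, fourier_one, pt] using h
  have hk : ContinuousMap.toLp (E := ℂ) 2 arc ℂ
      ((Real.sqrt (1 - ‖z‖ ^ 2) : ℂ) • ∑' n : ℕ, a ^ n) = k z := by
    apply Lp.ext
    filter_upwards [coeFn_k z, ContinuousMap.coeFn_toLp (p := 2) (𝕜 := ℂ) arc
      ((Real.sqrt (1 - ‖z‖ ^ 2) : ℂ) • ∑' n : ℕ, a ^ n)] with t h1 h2
    rw [h1, h2, ContinuousMap.smul_apply, happ, kernelFun, smul_eq_mul, div_eq_mul_inv]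
  rw [← hk]
  convert! (hs.hasSum.const_smul (Real.sqrt (1 - ‖z‖ ^ 2) : ℂ)).mapL
    (ContinuousMap.toLp (E := ℂ) 2 arc ℂ) using 1
  funext n
  have hn : (fourier (n : ℤ) : C(𝕋, ℂ)) = fourier 1 ^ n := by
    ext t
    simp [fourier_apply, AddCircle.toCircle_nsmul]
  rw [← map_smul, hn, ha, smul_pow, smul_smul]

theorem k_mem_hardy {z : ℂ} (hz : ‖z‖ < 1) : k z ∈ hardy := by
  refine (Submodule.isClosed_topologicalClosure _).mem_of_tendsto (hasSum_k hz)
    (Eventually.of_forall fun s => Submodule.sum_mem _ fun n _ => Submodule.smul_mem _ _ ?_)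
  exact Submodule.le_topologicalClosure _ (Submodule.subset_span ⟨n, rfl⟩)

theorem inner_fourier_k {z : ℂ} (hz : ‖z‖ < 1) (n : ℕ) :
    ⟪(fourierLp 2 (n : ℤ) : L2), k z⟫_ℂ = (Real.sqrt (1 - ‖z‖ ^ 2) : ℂ) * conj z ^ n := by
  refine ((hasSum_k hz).mapL (innerSL ℂ (fourierLp 2 (n : ℤ) : L2))).unique ?_
  simp only [innerSL_apply_apply, inner_smul_right, orthonormal_iff_ite.1 orthonormal_fourier,
    Nat.cast_inj]
  convert! hasSum_ite_eq n ((Real.sqrt (1 - ‖z‖ ^ 2) : ℂ) * conj z ^ n) using 2 with m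
  by_cases h : m = n
  · rw [if_pos h.symm, if_pos h, mul_one, h]
  · rw [if_neg (Ne.symm h), if_neg h, mul_zero]

theorem norm_k {z : ℂ} (hz : ‖z‖ < 1) : ‖k z‖ = 1 := by
  have hz2 : ‖z‖ ^ 2 < 1 := by nlinarith [norm_nonneg z]
  have h : ⟪k z, k z⟫_ℂ = 1 := by
    refine ((hasSum_k hz).mapL (innerSL ℂ (k z))).unique ?_
    have hg := ((hasSum_geometric_of_lt_one (sq_nonneg ‖z‖) hz2).mul_left (1 - ‖z‖ ^ 2)).mapL
      Complex.ofRealCLM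
    rw [mul_inv_cancel₀ (sub_pos.2 hz2).ne'] at hg
    simp only [Complex.ofRealCLM_apply, Complex.ofReal_one] at hg
    convert! hg using 1
    funext n
    rw [innerSL_apply_apply, inner_smul_right, ← inner_conj_symm, inner_fourier_k hz]
    have h1 : (Real.sqrt (1 - ‖z‖ ^ 2) : ℂ) * Real.sqrt (1 - ‖z‖ ^ 2) = ((1 - ‖z‖ ^ 2 : ℝ) : ℂ) := by
      rw [← Complex.ofReal_mul, Real.mul_self_sqrt (sub_pos.2 hz2).le]
    have h2 : conj z * z = ((‖z‖ ^ 2 : ℝ) : ℂ) := by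
      rw [RCLike.conj_mul]; simp
    rw [map_mul, map_pow, Complex.conj_conj, Complex.conj_ofReal, Complex.ofReal_mul,
      Complex.ofReal_pow, ← h1, ← h2, mul_pow]
    ring
  have h3 : ‖k z‖ ^ 2 = 1 := by rw [norm_sq_eq_re_inner (𝕜 := ℂ), h, RCLike.one_re]
  nlinarith [norm_nonneg (k z)]

theorem norm_antiK {z : ℂ} (hz : ‖z‖ < 1) : ‖antiK z‖ = 1 := by
  rw [← norm_k hz]
  rw [Lp.norm_def, Lp.norm_def]
  congr 1
  refine eLpNorm_congr_norm_ae ?_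
  filter_upwards [coeFn_k z, coeFn_antiK z] with t h1 h2
  rw [h1, h2, norm_mul, RCLike.norm_conj, RCLike.norm_conj, norm_pt, one_mul]

/-- Conjugation turns this into the pairing of `k z`, which has only nonnegative frequencies, with
the frequency -(n + 1). -/
theorem inner_fourier_antiK {z : ℂ} (hz : ‖z‖ < 1) (n : ℕ) :
    ⟪(fourierLp 2 (n : ℤ) : L2), antiK z⟫_ℂ = 0 := by
  have h0 : ⟪k z, (fourierLp 2 (-((n : ℤ) + 1)) : L2)⟫_ℂ = 0 := by
    rw [← inner_conj_symm, map_eq_zero]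
    refine ((hasSum_k hz).mapL (innerSL ℂ (fourierLp 2 (-((n : ℤ) + 1)) : L2))).unique ?_
    convert! hasSum_zero using 1
    funext m
    have : -((n : ℤ) + 1) ≠ m := by omega
    simp only [innerSL_apply_apply, inner_smul_right, orthonormal_iff_ite.1 orthonormal_fourier,
      if_neg this, mul_zero]
  rw [← h0, L2.inner_def, L2.inner_def]
  refine integral_congr_ae ?_
  filter_upwards [coeFn_k z, coeFn_antiK z, coeFn_fourierLp (T := 2 * Real.pi) 2 (n : ℤ),
    coeFn_fourierLp (T := 2 * Real.pi) 2 (-((n : ℤ) + 1))] with t h1 h2 h3 h4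
  simp only [RCLike.inner_apply, h1, h2, h3, h4]
  rw [fourier_neg, fourier_add, fourier_one, map_mul, pt]
  ring

theorem Pplus_k {z : ℂ} (hz : ‖z‖ < 1) : Pplus (k z) = k z :=
  Submodule.starProjection_eq_self_iff.2 (k_mem_hardy hz)

theorem Pminus_k {z : ℂ} (hz : ‖z‖ < 1) : Pminus (k z) = 0 := by
  rw [Pminus, sub_apply, Pplus_k hz, one_apply_eq_self, sub_self]

theorem Pplus_antiK {z : ℂ} (hz : ‖z‖ < 1) : Pplus (antiK z) = 0 := by
  rw [Pplus, Submodule.starProjection_apply_eq_zero_iff, hardy,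
    Submodule.orthogonal_closure, Submodule.mem_orthogonal]
  intro u hu
  induction hu using Submodule.span_induction with
  | mem x hx => obtain ⟨n, rfl⟩ := hx; exact inner_fourier_antiK hz n
  | zero => exact inner_zero_left _
  | add x y _ _ hx hy => rw [inner_add_left, hx, hy, add_zero]
  | smul c x _ hx => rw [inner_smul_left, hx, mul_zero]

theorem Pminus_antiK {z : ℂ} (hz : ‖z‖ < 1) : Pminus (antiK z) = antiK z := by
  rw [Pminus, sub_apply, Pplus_antiK hz, one_apply_eq_self,
    sub_zero]

/-! ### Asymptotic eigenvalues along a family of unit vectors -/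

/-- For almost every `ξ`, the vectors `v (r ξ)` are asymptotically eigenvectors of `T` with
eigenvalue `a ξ` as `r → 1⁻`. -/
def HasSymbol (v : ℂ → L2) (T : L2 →L[ℂ] L2) (a : LInf) : Prop :=
  ∀ᵐ ξ ∂arc, Tendsto (fun r : ℝ => T (v (r * pt ξ)) - a ξ • v (r * pt ξ)) (𝓝[<] 1) (𝓝 0)

theorem eventually_norm_lt_one (ξ : 𝕋) : ∀ᶠ r : ℝ in 𝓝[<] 1, ‖(r : ℂ) * pt ξ‖ < 1 := by
  filter_upwards [Ioo_mem_nhdsLT (zero_lt_one (α := ℝ))] with r hr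
  rw [norm_mul, norm_pt, mul_one, Complex.norm_real, Real.norm_of_nonneg hr.1.le]
  exact hr.2

variable {v : ℂ → L2} {S T : L2 →L[ℂ] L2} {a b : LInf}

theorem HasSymbol.add (hS : HasSymbol v S a) (hT : HasSymbol v T b) :
    HasSymbol v (S + T) (a + b) := by
  filter_upwards [hS, hT, Lp.coeFn_add a b] with ξ h1 h2 h3
  have := h1.add h2
  rw [add_zero] at this
  refine this.congr fun r => ?_
  rw [h3, Pi.add_apply, add_smul, add_apply]
  abel

theorem hasSymbol_algebraMap (c : ℂ) :
    HasSymbol v (algebraMap ℂ (L2 →L[ℂ] L2) c) (algebraMap ℂ LInf c) := by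
  filter_upwards [Lp.coeFn_smul c (1 : LInf), coeFn_one] with ξ h1 h2
  refine tendsto_const_nhds.congr fun r => ?_
  rw [Algebra.algebraMap_eq_smul_one, Algebra.algebraMap_eq_smul_one, h1, Pi.smul_apply, h2,
    smul_eq_mul, mul_one, smul_apply, one_apply_eq_self, sub_self]

/-- At a fixed ξ, STx - abx = S(Tx - bx) + b(Sx - ax), and S is bounded. -/
theorem HasSymbol.mul (hS : HasSymbol v S a) (hT : HasSymbol v T b) :
    HasSymbol v (S * T) (a * b) := by
  filter_upwards [hS, hT, coeFn_mul a b] with ξ h1 h2 h3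
  have := ((S.continuous.tendsto' 0 0 (map_zero S)).comp h2).add (h1.const_smul (b ξ))
  rw [smul_zero, add_zero] at this
  refine this.congr fun r => ?_
  rw [h3, Function.comp_apply, map_sub, map_smul, smul_sub, smul_smul, mul_comm (a ξ),
    mul_apply_eq_comp]
  abel

theorem HasSymbol.tendsto_inner (hv : ∀ z : ℂ, ‖z‖ < 1 → ‖v z‖ = 1)
    (hT : HasSymbol v T a) :
    ∀ᵐ ξ ∂arc, Tendsto (fun r : ℝ => ⟪v (r * pt ξ), T (v (r * pt ξ))⟫_ℂ) (𝓝[<] 1) (𝓝 (a ξ)) := by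
  filter_upwards [hT] with ξ h
  rw [tendsto_iff_norm_sub_tendsto_zero]
  refine squeeze_zero' (Eventually.of_forall fun _ => norm_nonneg _) ?_ (tendsto_zero_iff_norm_tendsto_zero.1 h)
  filter_upwards [eventually_norm_lt_one ξ] with r hr
  have h1 := norm_inner_le_norm (𝕜 := ℂ) (v (r * pt ξ)) (T (v (r * pt ξ)) - a ξ • v (r * pt ξ))
  rw [hv _ hr, one_mul, inner_sub_right, inner_smul_right, inner_self_eq_norm_sq_to_K,
    hv _ hr] at h1
  simpa using h1

theorem HasSymbol.unique (hv : ∀ z : ℂ, ‖z‖ < 1 → ‖v z‖ = 1)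
    (h1 : HasSymbol v T a) (h2 : HasSymbol v T b) : a = b := by
  apply Lp.ext
  filter_upwards [h1.tendsto_inner hv, h2.tendsto_inner hv] with ξ h1 h2
  exact tendsto_nhds_unique h1 h2

/-- Asymptotic eigenvectors of T need not be such for its adjoint, so a symbol of `star T` is
assumed; the inner products then identify it. -/
theorem HasSymbol.eq_star (hv : ∀ z : ℂ, ‖z‖ < 1 → ‖v z‖ = 1)
    (h1 : HasSymbol v T a) (h2 : HasSymbol v (star T) b) : b = star a := by
  apply Lp.ext
  filter_upwards [h1.tendsto_inner hv, h2.tendsto_inner hv, Lp.coeFn_star a] with ξ h1 h2 h3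
  refine tendsto_nhds_unique h2 ?_
  rw [h3, Pi.star_apply]
  refine h1.star.congr fun r => ?_
  rw [ContinuousLinearMap.star_eq_adjoint, ContinuousLinearMap.adjoint_inner_right]
  exact inner_conj_symm _ _

theorem HasSymbol.norm_le (hv : ∀ z : ℂ, ‖z‖ < 1 → ‖v z‖ = 1)
    (h : HasSymbol v T a) : ‖a‖ ≤ ‖T‖ := by
  refine (Lp.norm_le_of_ae_bound (norm_nonneg T) ?_).trans_eq
    (by simp)
  filter_upwards [h.tendsto_inner hv] with ξ h
  refine le_of_tendsto h.norm ?_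
  filter_upwards [eventually_norm_lt_one ξ] with r hr
  refine (norm_inner_le_norm _ _).trans ?_
  rw [hv _ hr, one_mul]
  exact T.le_of_opNorm_le_of_le le_rfl (hv _ hr).le |>.trans_eq (mul_one _)

/-- By contractivity the symbols form a Cauchy sequence in the complete space `LInf`; an ε/3
argument, off one null set serving all n, shows that their limit works. -/
theorem HasSymbol.of_tendsto (hv : ∀ z : ℂ, ‖z‖ < 1 → ‖v z‖ = 1)
    {T' : ℕ → L2 →L[ℂ] L2} {a' : ℕ → LInf}
    (h : ∀ n, HasSymbol v (T' n) (a' n)) (hT : Tendsto T' atTop (𝓝 T)) :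
    ∃ a, HasSymbol v T a := by
  have hsub (m n : ℕ) : HasSymbol v (T' m - T' n) (a' m - a' n) := by
    have := (h m).add ((hasSymbol_algebraMap (-1)).mul (h n))
    convert this using 1 <;> simp [sub_eq_add_neg]
  have hc : CauchySeq a' := by
    refine Metric.cauchySeq_iff.2 fun ε hε => ?_
    obtain ⟨N, hN⟩ := Metric.cauchySeq_iff.1 hT.cauchySeq ε hε
    refine ⟨N, fun m hm n hn => ?_⟩
    rw [dist_eq_norm]
    refine ((hsub m n).norm_le hv).trans_lt ?_
    rw [← dist_eq_norm]
    exact hN m hm n hn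
  obtain ⟨a, ha⟩ := cauchySeq_tendsto_of_complete hc
  refine ⟨a, ?_⟩
  have hae : ∀ᵐ ξ ∂arc, ∀ n, ‖a' n ξ - a ξ‖ ≤ ‖a' n - a‖ := by
    refine ae_all_iff.2 fun n => ?_
    filter_upwards [norm_coe_ae_le (a' n - a), Lp.coeFn_sub (a' n) a] with ξ h1 h2
    rwa [h2] at h1
  filter_upwards [hae, ae_all_iff.2 h] with ξ h1 h2
  rw [Metric.tendsto_nhds]
  intro ε hε
  have hT' := Metric.tendsto_nhds.1 hT (ε / 3) (by positivity)
  have ha' := Metric.tendsto_nhds.1 ha (ε / 3) (by positivity)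
  obtain ⟨n, hTn, han⟩ := (hT'.and ha').exists
  filter_upwards [eventually_norm_lt_one ξ, Metric.tendsto_nhds.1 (h2 n) (ε / 3) (by positivity)]
    with r hr hn
  rw [dist_zero_right] at hn ⊢
  rw [dist_eq_norm] at hTn han
  set x := v (r * pt ξ)
  have hx : ‖x‖ = 1 := hv _ hr
  have e : T x - a ξ • x = (T' n x - a' n ξ • x) - (T' n - T) x + (a' n ξ - a ξ) • x := by
    rw [sub_apply, sub_smul]; abel
  have e1 : ‖(T' n - T) x‖ ≤ ‖T' n - T‖ := by
    simpa [hx] using (T' n - T).le_opNorm x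
  have e2 : ‖(a' n ξ - a ξ) • x‖ ≤ ‖a' n - a‖ := by
    rw [norm_smul, hx, mul_one]; exact h1 n
  rw [e]
  refine (norm_add_le_of_le (norm_sub_le _ _) le_rfl).trans_lt ?_
  linarith

/-! ### Symbols of the generators -/

theorem enorm_eq_lintegral (x : L2) : ‖x‖ₑ = (∫⁻ t, ‖x t‖ₑ ^ 2 ∂arc) ^ (1 / 2 : ℝ) := by
  rw [Lp.enorm_def, eLpNorm_eq_lintegral_rpow_enorm_toReal two_ne_zero ENNReal.ofNat_ne_top]
  simp

/-- Only the modulus of the vectors enters ‖(f - f(ξ)) v‖, so one proof serves both families. -/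
theorem hasSymbol_mulOp (hv : ∀ z, ∀ᵐ t ∂arc, ‖v z t‖ = ‖kernelFun z t‖) (f : LInf) :
    HasSymbol v (mulOp f) f := by
  filter_upwards [ae_tendsto_lintegral_kernelFun f] with ξ h
  have h2 := ((ENNReal.continuous_rpow_const (y := 1 / 2)).tendsto 0).comp h
  rw [ENNReal.zero_rpow_of_pos (by norm_num)] at h2
  rw [tendsto_zero_iff_norm_tendsto_zero]
  have h3 := (ENNReal.tendsto_toReal ENNReal.zero_ne_top).comp h2
  refine h3.congr fun r => ?_
  rw [← toReal_enorm, enorm_eq_lintegral, Function.comp_apply, Function.comp_apply]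
  congr 2
  refine lintegral_congr_ae ?_
  set x := v (r * pt ξ)
  filter_upwards [hv (r * pt ξ), coeFn_mulOp f x, Lp.coeFn_smul (f ξ) x,
    Lp.coeFn_sub (mulOp f x) (f ξ • x)] with t h1 h2 h3 h4
  rw [h4, Pi.sub_apply, h2, h3, Pi.smul_apply, smul_eq_mul, ← sub_mul, enorm_mul, mul_pow,
    ← ofReal_norm, ← ofReal_norm (kernelFun _ t), ← ofReal_norm (x t), h1, ofReal_norm]

theorem hasSymbol_of_forall_eq {c : ℂ} (h : ∀ z : ℂ, ‖z‖ < 1 → T (v z) = c • v z) :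
    HasSymbol v T (algebraMap ℂ LInf c) := by
  filter_upwards [hasSymbol_algebraMap (v := v) c] with ξ hξ
  refine hξ.congr' ?_
  filter_upwards [eventually_norm_lt_one ξ] with r hr
  rw [h _ hr, Algebra.algebraMap_eq_smul_one (A := L2 →L[ℂ] L2), smul_apply, one_apply_eq_self]

/-- By the product rule, every term containing `Pminus` has symbol 0. -/
theorem hasSymbol_k_R (H : Matrix (Fin 2) (Fin 2) LInf) : HasSymbol k (R H) (H 0 0) := by
  have hm : ∀ f, HasSymbol k (mulOp f) f := hasSymbol_mulOp fun z => by
    filter_upwards [coeFn_k z] with t ht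
    rw [ht]
  have hp : HasSymbol k Pplus 1 := by
    rw [← map_one (algebraMap ℂ LInf)]
    exact hasSymbol_of_forall_eq fun z hz => by rw [Pplus_k hz, one_smul]
  have hn : HasSymbol k Pminus 0 := by
    rw [← map_zero (algebraMap ℂ LInf)]
    exact hasSymbol_of_forall_eq fun z hz => by rw [Pminus_k hz, zero_smul]
  have h := ((((hp.mul (hm (H 0 0))).mul hp).add ((hn.mul (hm (H 1 0))).mul hp)).add
    ((hp.mul (hm (H 0 1))).mul hn)).add ((hn.mul (hm (H 1 1))).mul hn)
  rw [R]
  convert h using 1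
  simp

theorem hasSymbol_antiK_R (H : Matrix (Fin 2) (Fin 2) LInf) :
    HasSymbol antiK (R H) (H 1 1) := by
  have hm : ∀ f, HasSymbol antiK (mulOp f) f := hasSymbol_mulOp fun z => by
    filter_upwards [coeFn_antiK z] with t ht
    rw [ht, norm_mul, RCLike.norm_conj, RCLike.norm_conj, norm_pt, one_mul]
  have hp : HasSymbol antiK Pplus 0 := by
    rw [← map_zero (algebraMap ℂ LInf)]
    exact hasSymbol_of_forall_eq fun z hz => by rw [Pplus_antiK hz, zero_smul]
  have hn : HasSymbol antiK Pminus 1 := by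
    rw [← map_one (algebraMap ℂ LInf)]
    exact hasSymbol_of_forall_eq fun z hz => by rw [Pminus_antiK hz, one_smul]
  have h := ((((hp.mul (hm (H 0 0))).mul hp).add ((hn.mul (hm (H 1 0))).mul hp)).add
    ((hp.mul (hm (H 0 1))).mul hn)).add ((hn.mul (hm (H 1 1))).mul hn)
  rw [R]
  convert h using 1
  simp

/-! ### The symbol homomorphism -/

/-- A closed property of elements of `ℜ_{L^∞}` that is stable under sums and products holds
everywhere if it holds for scalars and for the operators `R_H`. -/
theorem RAlg_induction {p : RAlg → Prop} (hR : ∀ H, p (Rel H))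
    (hc : ∀ c : ℂ, p (algebraMap ℂ RAlg c)) (hadd : ∀ S T, p S → p T → p (S + T))
    (hmul : ∀ S T, p S → p T → p (S * T))
    (hlim : ∀ (T : RAlg) (T' : ℕ → RAlg), (∀ n, p (T' n)) → Tendsto T' atTop (𝓝 T) → p T)
    (T : RAlg) : p T := by
  have hle : ∀ {x}, x ∈ StarAlgebra.adjoin ℂ (Set.range R) → x ∈ RAlg :=
    fun hx => StarSubalgebra.le_topologicalClosure _ hx
  have hadj : ∀ x (hx : x ∈ StarAlgebra.adjoin ℂ (Set.range R)), p ⟨x, hle hx⟩ := by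
    -- The generators are closed under adjoints, so the induction needs no case for `star`.
    have hst : star (Set.range R) = Set.range R := by
      refine Set.Subset.antisymm (fun x hx => ?_) fun x hx => ?_
      · obtain ⟨H, hH⟩ := hx
        exact ⟨H.conjTranspose, by rw [← star_R, hH, star_star]⟩
      · obtain ⟨H, rfl⟩ := hx
        exact ⟨H.conjTranspose, (star_R H).symm⟩
    have heq : ∀ x, x ∈ StarAlgebra.adjoin ℂ (Set.range R) ↔
        x ∈ Algebra.adjoin ℂ (Set.range R) := fun x => by
      rw [← StarSubalgebra.mem_toSubalgebra, StarAlgebra.adjoin_toSubalgebra, hst, Set.union_self]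
    have key : ∀ x ∈ Algebra.adjoin ℂ (Set.range R), ∃ h : x ∈ RAlg, p ⟨x, h⟩ := by
      intro x hx
      induction hx using Algebra.adjoin_induction with
      | mem x hx => obtain ⟨H, rfl⟩ := hx; exact ⟨R_mem H, hR H⟩
      | algebraMap c => exact ⟨(algebraMap ℂ RAlg c).2, hc c⟩
      | add x y _ _ ihx ihy =>
        obtain ⟨h1, h1'⟩ := ihx
        obtain ⟨h2, h2'⟩ := ihy
        exact ⟨add_mem h1 h2, hadd _ _ h1' h2'⟩
      | mul x y _ _ ihx ihy =>
        obtain ⟨h1, h1'⟩ := ihx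
        obtain ⟨h2, h2'⟩ := ihy
        exact ⟨mul_mem h1 h2, hmul _ _ h1' h2'⟩
    exact fun x hx => (key x ((heq x).1 hx)).2
  have hT : (T : L2 →L[ℂ] L2) ∈
      closure (StarAlgebra.adjoin ℂ (Set.range R) : Set (L2 →L[ℂ] L2)) := T.2
  obtain ⟨T', hmem, htend⟩ := mem_closure_iff_seq_limit.1 hT
  exact hlim T (fun n => ⟨T' n, hle (hmem n)⟩) (fun n => hadj _ (hmem n))
    (tendsto_subtype_rng.2 htend)

theorem exists_hasSymbol {v : ℂ → L2} (hv : ∀ z : ℂ, ‖z‖ < 1 → ‖v z‖ = 1)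
    (hR : ∀ H, ∃ a, HasSymbol v (R H) a) (T : RAlg) : ∃ a, HasSymbol v (T : L2 →L[ℂ] L2) a := by
  induction T using RAlg_induction with
  | hR H => exact hR H
  | hc c => exact ⟨_, hasSymbol_algebraMap c⟩
  | hadd S T hS hT =>
    obtain ⟨a, ha⟩ := hS
    obtain ⟨b, hb⟩ := hT
    exact ⟨_, ha.add hb⟩
  | hmul S T hS hT =>
    obtain ⟨a, ha⟩ := hS
    obtain ⟨b, hb⟩ := hT
    exact ⟨_, ha.mul hb⟩
  | hlim T T' h hT =>
    choose a ha using h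
    exact HasSymbol.of_tendsto hv ha ((continuous_subtype_val.tendsto T).comp hT)

/-- The `*`-homomorphism sending `T` to its asymptotic eigenvalue along `v`. -/
def symbolHom (v : ℂ → L2) (hv : ∀ z : ℂ, ‖z‖ < 1 → ‖v z‖ = 1)
    (h : ∀ T : RAlg, ∃ a, HasSymbol v (T : L2 →L[ℂ] L2) a) : RAlg →⋆ₐ[ℂ] LInf where
  toFun T := (h T).choose
  map_one' := (h 1).choose_spec.unique hv (by simpa using hasSymbol_algebraMap (v := v) 1)
  map_mul' S T := (h (S * T)).choose_spec.unique hv ((h S).choose_spec.mul (h T).choose_spec)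
  map_zero' := (h 0).choose_spec.unique hv (by simpa using hasSymbol_algebraMap (v := v) 0)
  map_add' S T := (h (S + T)).choose_spec.unique hv ((h S).choose_spec.add (h T).choose_spec)
  commutes' c := (h (algebraMap ℂ RAlg c)).choose_spec.unique hv (hasSymbol_algebraMap c)
  map_star' T := (h T).choose_spec.eq_star hv (h (star T)).choose_spec

theorem exists_hasSymbol_k : ∀ T : RAlg, ∃ a, HasSymbol k (T : L2 →L[ℂ] L2) a :=
  exists_hasSymbol (fun _ => norm_k) fun H => ⟨_, hasSymbol_k_R H⟩

theorem exists_hasSymbol_antiK : ∀ T : RAlg, ∃ a, HasSymbol antiK (T : L2 →L[ℂ] L2) a :=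
  exists_hasSymbol (fun _ => norm_antiK) fun H => ⟨_, hasSymbol_antiK_R H⟩

/-- The symbol map `ρ`. -/
def symbol : RAlg →⋆ₐ[ℂ] LInf × LInf :=
  (symbolHom k (fun _ => norm_k) exists_hasSymbol_k).prod
    (symbolHom antiK (fun _ => norm_antiK) exists_hasSymbol_antiK)

theorem hasSymbol_symbol_fst (T : RAlg) : HasSymbol k (T : L2 →L[ℂ] L2) (symbol T).1 :=
  (exists_hasSymbol_k T).choose_spec

theorem hasSymbol_symbol_snd (T : RAlg) : HasSymbol antiK (T : L2 →L[ℂ] L2) (symbol T).2 :=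
  (exists_hasSymbol_antiK T).choose_spec

theorem symbol_Rel (H : Matrix (Fin 2) (Fin 2) LInf) : symbol (Rel H) = (H 0 0, H 1 1) :=
  Prod.ext ((hasSymbol_symbol_fst _).unique (fun _ => norm_k) (hasSymbol_k_R H))
    ((hasSymbol_symbol_snd _).unique (fun _ => norm_antiK) (hasSymbol_antiK_R H))

theorem norm_symbol_le (T : RAlg) : ‖symbol T‖ ≤ ‖T‖ :=
  max_le ((hasSymbol_symbol_fst T).norm_le fun _ => norm_k)
    ((hasSymbol_symbol_snd T).norm_le fun _ => norm_antiK)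

theorem continuous_symbol : Continuous symbol :=
  AddMonoidHomClass.continuous_of_bound symbol 1 fun T => by
    rw [one_mul]; exact norm_symbol_le T

/-! ### The diagonal section and the kernel -/

/-- The operator with diagonal matrix symbol. -/
def diagRel (x : LInf × LInf) : RAlg := Rel !![x.1, 0; 0, x.2]

theorem symbol_diagRel (x : LInf × LInf) : symbol (diagRel x) = x := symbol_Rel _

theorem mulOp_add (f g : LInf) : mulOp (f + g) = mulOp f + mulOp g := map_add _ f g

theorem mulOp_zero : mulOp 0 = 0 := map_zero ((ContinuousLinearMap.mul ℂ ℂ).holderL arc ∞ 2 2)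

theorem mulOp_one : mulOp 1 = 1 := by
  ext1 x
  apply Lp.ext
  filter_upwards [coeFn_mulOp 1 x, coeFn_one] with t h1 h2
  rw [h1, h2, one_mul, one_apply_eq_self]

theorem norm_mulOp_le (f : LInf) : ‖mulOp f‖ ≤ ‖f‖ := by
  refine ContinuousLinearMap.opNorm_le_bound _ (norm_nonneg f) fun x => ?_
  refine Lp.norm_le_mul_norm_of_ae_le_mul ?_
  filter_upwards [coeFn_mulOp f x, norm_coe_ae_le f] with t h1 h2
  rw [h1, norm_mul]
  gcongr

theorem coe_diagRel (x : LInf × LInf) : (diagRel x : L2 →L[ℂ] L2) =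
    Pplus * mulOp x.1 * Pplus + Pminus * mulOp x.2 * Pminus := by
  simp [diagRel, Rel, R, mulOp_zero]

theorem diagRel_add (x y : LInf × LInf) : diagRel (x + y) = diagRel x + diagRel y := by
  apply Subtype.ext
  rw [AddMemClass.coe_add, coe_diagRel, coe_diagRel, coe_diagRel, Prod.fst_add, Prod.snd_add,
    mulOp_add, mulOp_add]
  noncomm_ring

theorem Pplus_mul_self : Pplus * Pplus = Pplus := hardy.isIdempotentElem_starProjection

theorem diagRel_one : diagRel 1 = 1 := by
  apply Subtype.ext
  rw [coe_diagRel, Prod.fst_one, Prod.snd_one, mulOp_one, mul_one, mul_one, Pminus, mul_sub,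
    sub_mul, sub_mul, Pplus_mul_self]
  simp

theorem inner_Pplus_Pminus (x y : L2) : ⟪Pplus x, Pminus y⟫_ℂ = 0 := by
  have h : star Pplus * Pminus = 0 := by
    rw [star_Pplus, Pminus, mul_sub, Pplus_mul_self, mul_one, sub_self]
  rw [← ContinuousLinearMap.adjoint_inner_right, ← ContinuousLinearMap.star_eq_adjoint,
    ← mul_apply_eq_comp, h, zero_apply, inner_zero_right]

theorem norm_add_sq_Pplus_Pminus (x y : L2) :
    ‖Pplus x + Pminus y‖ ^ 2 = ‖Pplus x‖ ^ 2 + ‖Pminus y‖ ^ 2 := by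
  simpa [sq] using norm_add_sq_eq_norm_sq_add_norm_sq_of_inner_eq_zero _ _ (inner_Pplus_Pminus x y)

theorem norm_sq_eq_Pplus_Pminus (x : L2) : ‖x‖ ^ 2 = ‖Pplus x‖ ^ 2 + ‖Pminus x‖ ^ 2 := by
  rw [← norm_add_sq_Pplus_Pminus]
  simp [Pminus]

/-- The operator is block diagonal for L² = H² ⊕ (H²)^⊥, so Pythagoras bounds its norm by the larger
of the two block norms. -/
theorem norm_diagRel_le (x : LInf × LInf) : ‖diagRel x‖ ≤ ‖x‖ := by
  change ‖(diagRel x : L2 →L[ℂ] L2)‖ ≤ ‖x‖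
  refine ContinuousLinearMap.opNorm_le_bound _ (norm_nonneg x) fun y => ?_
  refine le_of_sq_le_sq ?_ (by positivity)
  rw [coe_diagRel, add_apply]
  simp only [mul_apply_eq_comp]
  rw [norm_add_sq_Pplus_Pminus, mul_pow, norm_sq_eq_Pplus_Pminus y, mul_add, ← mul_pow, ← mul_pow]
  have hb (z : L2) (f : LInf) (hf : ‖f‖ ≤ ‖x‖) : ‖mulOp f z‖ ≤ ‖x‖ * ‖z‖ :=
    (mulOp f).le_of_opNorm_le ((norm_mulOp_le f).trans hf) z
  gcongr
  · refine le_trans ?_ (hb _ _ (norm_fst_le x))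
    have h := norm_sq_eq_Pplus_Pminus (mulOp x.1 (Pplus y))
    exact le_of_sq_le_sq (by nlinarith [sq_nonneg ‖Pminus (mulOp x.1 (Pplus y))‖]) (norm_nonneg _)
  · refine le_trans ?_ (hb _ _ (norm_snd_le x))
    have h := norm_sq_eq_Pplus_Pminus (mulOp x.2 (Pminus y))
    exact le_of_sq_le_sq (by nlinarith [sq_nonneg ‖Pplus (mulOp x.2 (Pminus y))‖]) (norm_nonneg _)

theorem continuous_diagRel : Continuous diagRel :=
  AddMonoidHomClass.continuous_of_bound (AddMonoidHom.mk' diagRel diagRel_add) 1 fun x => by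
    rw [one_mul]; exact norm_diagRel_le x

theorem isClosed_SR : IsClosed (SR : Set RAlg) := by
  have : (SR : Set RAlg) = ⋂ I ∈ {I : Ideal RAlg | I.IsTwoSided ∧ IsClosed (I : Set RAlg) ∧
      semicommutators ⊆ I}, (I : Set RAlg) := by
    rw [SR, Submodule.coe_sInf]
  rw [this]
  exact isClosed_biInter fun I hI => hI.2.1

theorem semicommutators_subset_SR : semicommutators ⊆ (SR : Set RAlg) :=
  fun _ hT => mem_SR.2 fun _ _ _ h => h hT

theorem Rel_sub_diagRel_mem_SR (H : Matrix (Fin 2) (Fin 2) LInf) :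
    Rel H - diagRel (H 0 0, H 1 1) ∈ SR := by
  -- The identity matrix has R = 1, and the off-diagonal entries of the subtracted symbol are free:
  -- choosing 0 isolates the off-diagonal part of R_H.
  refine semicommutators_subset_SR ⟨!![1, 0; 0, 1], H, 0, 0, ?_⟩
  have h1 : Rel !![1, 0; 0, 1] = 1 := diagRel_one
  rw [h1, one_mul, diagRel]
  simp

theorem diagRel_mul_sub_mem_SR (x y : LInf × LInf) :
    diagRel x * diagRel y - diagRel (x * y) ∈ SR :=
  semicommutators_subset_SR ⟨!![x.1, 0; 0, x.2], !![y.1, 0; 0, y.2], 0, 0, rfl⟩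

theorem sub_diagRel_symbol_mem_SR (T : RAlg) : T - diagRel (symbol T) ∈ SR := by
  induction T using RAlg_induction with
  | hR H => rw [symbol_Rel]; exact Rel_sub_diagRel_mem_SR H
  | hc c =>
    have hd : diagRel (algebraMap ℂ LInf c, algebraMap ℂ LInf c) = algebraMap ℂ RAlg c := by
      apply Subtype.ext
      have hm : mulOp (algebraMap ℂ LInf c) = c • 1 := by
        rw [Algebra.algebraMap_eq_smul_one, ← mulOp_one]
        exact map_smul ((ContinuousLinearMap.mul ℂ ℂ).holderL arc ∞ 2 2) c 1
      have h1 := congrArg (Subtype.val) diagRel_one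
      rw [coe_diagRel, Prod.fst_one, Prod.snd_one, mulOp_one] at h1
      rw [coe_diagRel, hm]
      simp only [mul_smul_comm, smul_mul_assoc, ← smul_add]
      rw [h1, Algebra.algebraMap_eq_smul_one]
      rfl
    have hs : symbol (algebraMap ℂ RAlg c) = (algebraMap ℂ LInf c, algebraMap ℂ LInf c) :=
      AlgHomClass.commutes symbol c
    rw [hs, hd, sub_self]
    exact SR.zero_mem
  | hadd S T hS hT =>
    rw [map_add, diagRel_add, add_sub_add_comm]
    exact SR.add_mem hS hT
  | hmul S T hS hT =>
    -- The first two terms lie in the ideal by induction; the last is a semicommutator.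
    have e : S * T - diagRel (symbol (S * T)) = (S - diagRel (symbol S)) * T +
        diagRel (symbol S) * (T - diagRel (symbol T)) +
        (diagRel (symbol S) * diagRel (symbol T) - diagRel (symbol S * symbol T)) := by
      rw [map_mul]; noncomm_ring
    rw [e]
    exact SR.add_mem (SR.add_mem (Ideal.mul_mem_right _ _ hS) (SR.mul_mem_left _ hT))
      (diagRel_mul_sub_mem_SR _ _)
  | hlim T T' h hT =>
    have hcont : Continuous fun T : RAlg => T - diagRel (symbol T) :=
      continuous_id.sub (continuous_diagRel.comp continuous_symbol)
    exact isClosed_SR.mem_of_tendsto ((hcont.tendsto T).comp hT) (Eventually.of_forall h)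

theorem mem_SR_iff_symbol_eq_zero {T : RAlg} : T ∈ SR ↔ symbol T = 0 := by
  constructor
  · intro hT
    -- Minimality of `SR`, tested against the kernel: semicommutators vanish there because ρ sees
    -- only the diagonal entries.
    refine mem_SR.1 hT (RingHom.ker symbol) inferInstance ?_ ?_
    · exact isClosed_singleton.preimage continuous_symbol
    · rintro _ ⟨H₁, H₂, φ, g, rfl⟩
      change symbol _ = 0
      rw [map_sub, map_mul, symbol_Rel, symbol_Rel, symbol_Rel, Prod.mk_mul_mk]
      exact sub_self _
  · intro hT
    have h := sub_diagRel_symbol_mem_SR T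
    have h0 : diagRel 0 = 0 := (AddMonoidHom.mk' diagRel diagRel_add).map_zero
    rwa [hT, h0, sub_zero] at h

/-! ### The quotient algebra -/

theorem symbol_surjective : Function.Surjective symbol := fun x => ⟨_, symbol_diagRel x⟩

/-- The homomorphism of the quotient algebra induced by the symbol map. -/
def quotientHom : RAlg ⧸ SR →+* LInf × LInf :=
  Ideal.Quotient.lift SR (symbol : RAlg →+* LInf × LInf)
    fun _ h => mem_SR_iff_symbol_eq_zero.1 h

theorem quotientHom_mk (T : RAlg) : quotientHom (Ideal.Quotient.mk SR T) = symbol T := rfl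

theorem quotientHom_bijective : Function.Bijective quotientHom := by
  refine ⟨(injective_iff_map_eq_zero quotientHom).2 fun q hq => ?_,
    fun x => ⟨Ideal.Quotient.mk SR (diagRel x), symbol_diagRel x⟩⟩
  obtain ⟨T, rfl⟩ := Ideal.Quotient.mk_surjective q
  rw [quotientHom_mk] at hq
  exact Ideal.Quotient.eq_zero_iff_mem.2 (mem_SR_iff_symbol_eq_zero.2 hq)

theorem quotientHom_star (q : RAlg ⧸ SR) : quotientHom (star q) = star (quotientHom q) := by
  obtain ⟨T, rfl⟩ := Ideal.Quotient.mk_surjective q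
  have h : star (Ideal.Quotient.mk SR T) = Ideal.Quotient.mk SR (star T) := rfl
  rw [h, quotientHom_mk, quotientHom_mk, map_star]

theorem quotientHom_smul (c : ℂ) (q : RAlg ⧸ SR) :
    quotientHom (c • q) = c • quotientHom q := by
  obtain ⟨T, rfl⟩ := Ideal.Quotient.mk_surjective q
  have h : c • Ideal.Quotient.mk SR T = Ideal.Quotient.mk SR (c • T) := rfl
  rw [h, quotientHom_mk, quotientHom_mk, map_smul]

/-- The `*`-isomorphism induced by the symbol map. -/
def quotientEquiv : (RAlg ⧸ SR) ≃⋆ₐ[ℂ] (LInf × LInf) :=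
  { RingEquiv.ofBijective quotientHom quotientHom_bijective with
    map_star' := quotientHom_star
    map_smul' := quotientHom_smul }

theorem quotientEquiv_mk (T : RAlg) : quotientEquiv (Ideal.Quotient.mk SR T) = symbol T := rfl

/-- For ≤, ρ is contractive on lifts of nearly minimal norm. For ≥, `diagRel (symbol T)` is a lift
of norm at most ‖ρ(T)‖. -/
theorem norm_quotientEquiv (q : RAlg ⧸ SR) : ‖quotientEquiv q‖ = ‖q‖ := by
  refine le_antisymm ?_ ?_
  · refine le_of_forall_pos_le_add fun ε hε => ?_
    obtain ⟨T, rfl, hT⟩ := Submodule.Quotient.norm_mk_lt q hε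
    exact (norm_symbol_le T).trans hT.le
  · obtain ⟨T, rfl⟩ := Ideal.Quotient.mk_surjective q
    have h : Ideal.Quotient.mk SR T = Ideal.Quotient.mk SR (diagRel (symbol T)) :=
      Ideal.Quotient.eq.2 (sub_diagRel_symbol_mem_SR T)
    rw [quotientEquiv_mk, h]
    exact (Submodule.Quotient.norm_mk_le SR _).trans (norm_diagRel_le _)

theorem isometry_quotientEquiv : Isometry quotientEquiv :=
  AddMonoidHomClass.isometry_of_norm quotientEquiv norm_quotientEquiv

end GSIO

end

open GSIO in
theorem mainTheorem1 :
    ∃ ρ : RAlg →⋆ₐ[ℂ] LInf × LInf,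
      -- the symbol map is given by radial limits
      (∀ T : RAlg, ∀ᵐ ξ ∂arc,
        Tendsto (fun r : ℝ => ⟪k (r * pt ξ), (T : L2 →L[ℂ] L2) (k (r * pt ξ))⟫_ℂ)
          (𝓝[<] 1) (𝓝 ((ρ T).1 ξ)) ∧
        Tendsto (fun r : ℝ => ⟪antiK (r * pt ξ), (T : L2 →L[ℂ] L2) (antiK (r * pt ξ))⟫_ℂ)
          (𝓝[<] 1) (𝓝 ((ρ T).2 ξ))) ∧
      -- `0 → SR → RAlg → LInf × LInf → 0` is exact
      Function.Injective (SR.subtype : SR → RAlg) ∧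
      Function.Exact (SR.subtype : SR → RAlg) ρ ∧
      Function.Surjective ρ ∧
      -- `ρ` induces an isometric `*`-isomorphism of the quotient algebra
      ∃ e : (RAlg ⧸ SR) ≃⋆ₐ[ℂ] (LInf × LInf),
        Isometry e ∧ ∀ T : RAlg, e (Ideal.Quotient.mk SR T) = ρ T := by
  refine ⟨symbol, fun T => ?_, Subtype.val_injective, fun T => ?_, symbol_surjective,
    quotientEquiv, isometry_quotientEquiv, quotientEquiv_mk⟩
  · exact ((hasSymbol_symbol_fst T).tendsto_inner fun _ => norm_k).and
      ((hasSymbol_symbol_snd T).tendsto_inner fun _ => norm_antiK)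
  · rw [← mem_SR_iff_symbol_eq_zero]
    exact ⟨fun h => ⟨⟨T, h⟩, rfl⟩, fun ⟨x, hx⟩ => hx ▸ x.2⟩
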